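/- Let $G=(V,E)$ be a connected finite (simple) graph with vertex measure $\mu:V\to(0,+\infty)$ and positive symmetric edge weights $w_{xy}=w_{yx}>0$ for $xy\in E$. For $u:V\to\mathbb{R}$ put $$\Delta u(x)=\frac{1}{\mu(x)}\sum_{y\sim x}w_{xy}\,(u(y)-u(x)),\qquad \int_V u\,d\mu=\sum_{x\in V}\mu(x)u(x).$$ Let $f:V\to\mathbb{R}$ and, for $\lambda\in\mathbb{R}$, consider the equation $$\Delta u=\lambda e^{u}(e^{u}-1)+f\quad\text{on } V\qquad(\ast)$$ for $u:V\to\mathbb{R}$. (a) If $\lambda\int_V f\,d\mu<0$, then $(\ast)$ has a solution. (b)(i) If $\int_V f\,d\mu>0$, there exists a real number $\Lambda^*>0$ such that $(\ast)$ has at least two different solutions for every $\lambda>\Lambda^*$, no solution for $0<\lambda<\Lambda^*$, and at least one solution for $\lambda=\Lambda^*$. (b)(ii) If $\int_V f\,d\mu<0$, there exists a real number $\Lambda_*<0$ such that $(\ast)$ has at least two different solutions for every $\lambda<\Lambda_*$, no solution for $\Lambda_*<\lambda<0$, and at least one solution for $\lambda=\Lambda_*$. -/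

import Mathlib

/-- The Laplacian of a weighted graph with vertex measure `μ` and edge weights `w`:
`Δu(x) = (1 / μ(x)) ∑_{y ∼ x} w_{xy} (u(y) - u(x))`. -/
noncomputable def graphLaplacian {V : Type*} [Fintype V] (G : SimpleGraph V)
    [DecidableRel G.Adj] (μ : V → ℝ) (w : V → V → ℝ) (u : V → ℝ) (x : V) : ℝ :=
  (1 / μ x) * ∑ y ∈ G.neighborFinset x, w x y * (u y - u x)

/-- The integral of a function on the vertices: `∫_V u dμ = ∑_x μ(x) u(x)`. -/
def vertexIntegral {V : Type*} [Fintype V] (μ : V → ℝ) (u : V → ℝ) : ℝ :=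
  ∑ x, μ x * u x

/-- `u` solves the Chern-Simons Higgs equation `Δu = lam e^u (e^u - 1) + f` at every vertex. -/
def IsChernSimonsHiggsSolution {V : Type*} [Fintype V] (G : SimpleGraph V)
    [DecidableRel G.Adj] (μ : V → ℝ) (w : V → V → ℝ) (lam : ℝ) (f : V → ℝ)
    (u : V → ℝ) : Prop :=
  ∀ x, graphLaplacian G μ w u x
    = lam * Real.exp (u x) * (Real.exp (u x) - 1) + f x

/-!
The proof is variational and order-theoretic, and replaces topological degree by a connectedness
argument. Write `h(s) = eˢ (eˢ - 1)`.

For a bounded Lipschitz `g`, a small explicit Euler step of the flow `∂ₜu = Δu - g(u) - f`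
(`flowStep`) preserves the pointwise order (`flowStep_mono`) and decreases the energy
(`energy_flowStep_le`). Two existence principles for `Δu = g(u) + f` follow.
* If a subsolution lies below a supersolution, then iterating the step from the subsolution converges
  to a solution between them (`exists_solution_between`).
* If a strict supersolution `b` lies below a strict subsolution `a`, then there is a solution which is
  neither everywhere below `b` nor everywhere above `a` (`exists_solution_of_reversed`). The regions
  `u < b` and `u > a` are open and invariant under the step, so by connectedness of the segment from
  `b` to `a` the orbit of some point of it enters neither. The energy is coercive on the complement of
  both regions, by the Poincaré inequality, so this orbit is bounded, and descent of the energy makes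
  it accumulate at a solution.

Both apply to `g = λ h` after truncating `h` at a large height, which the a priori bound from the
integrated equation `λ ∫ h(u) = - ∫ f` makes harmless.

Let `f̄` be the mean of `f`. Very low and very high solutions of `Δv = f - f̄` (`exists_poisson`) are
strict sub- or supersolutions, depending on the signs of `λ` and `f̄`, because `h` vanishes at `-∞` and
is unbounded at `+∞`. If `λ ∫ f < 0`, then for `λ > 0` the low one is a subsolution and the high one a
supersolution, and for `λ < 0` it is the other way round; the two principles give a solution.

If `λ ∫ f > 0`, then both are supersolutions when `λ > 0` and both are subsolutions when `λ < 0`.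
A constant serves as the missing sub- or supersolution for large `|λ|`. Moreover, a solution for some
`λ₀`, translated by `log (λ₀ / λ)`, is a strict sub- or supersolution, respectively, for every
further `λ` (`mul_higgs_lt_mul_higgs_shift`). One principle gives a solution on one side of it, the
other a solution that is not on that side, so these are distinct. Integrating the equation excludes
small `|λ|`, and solutions are uniformly bounded (`exists_solution_bound`), so by compactness the
solvable parameters have a smallest modulus (`exists_threshold`), which is the threshold sought.
-/

/-! ### The graph Laplacian, the Dirichlet form and the Poisson equation -/

section Laplacian

variable {V : Type*} [Fintype V] (G : SimpleGraph V) [DecidableRel G.Adj]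

/-- The edge weights extended by zero to all pairs of vertices, so that sums over neighbours become
sums over `V`. -/
def edgeWeight (w : V → V → ℝ) (x y : V) : ℝ := if G.Adj x y then w x y else 0

/-- The Dirichlet form `½ ∑_{x,y} w_{xy} (u(y) - u(x)) (v(y) - v(x))`; each edge is counted in both
orientations, which the factor `½` compensates. -/
noncomputable def dirichletForm (w : V → V → ℝ) (u v : V → ℝ) : ℝ :=
  (1 / 2) * ∑ x, ∑ y, edgeWeight G w x y * ((u y - u x) * (v y - v x))

variable {G} {μ : V → ℝ} {w : V → V → ℝ}

omit [Fintype V] in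
lemma edgeWeight_nonneg (hw : ∀ x y, G.Adj x y → 0 < w x y) (x y : V) :
    0 ≤ edgeWeight G w x y := by
  unfold edgeWeight
  split_ifs with h
  · exact (hw x y h).le
  · exact le_rfl

omit [Fintype V] in
lemma edgeWeight_symm (hs : ∀ x y, G.Adj x y → w x y = w y x) (x y : V) :
    edgeWeight G w x y = edgeWeight G w y x := by
  unfold edgeWeight
  by_cases h : G.Adj x y
  · simp [h, h.symm, hs x y h]
  · have h' : ¬ G.Adj y x := fun k => h k.symm
    simp [h, h']

lemma graphLaplacian_eq (u : V → ℝ) (x : V) :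
    graphLaplacian G μ w u x = (1 / μ x) * ∑ y, edgeWeight G w x y * (u y - u x) := by
  simp only [graphLaplacian, edgeWeight, ite_mul, zero_mul, ← Finset.sum_filter]
  rw [SimpleGraph.neighborFinset_eq_filter]

lemma mul_graphLaplacian (hμ : ∀ x, 0 < μ x) (u : V → ℝ) (x : V) :
    μ x * graphLaplacian G μ w u x = ∑ y, edgeWeight G w x y * (u y - u x) := by
  rw [graphLaplacian_eq, ← mul_assoc, mul_one_div_cancel (hμ x).ne', one_mul]

lemma graphLaplacian_add_const (u : V → ℝ) (c : ℝ) (x : V) :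
    graphLaplacian G μ w (fun y => u y + c) x = graphLaplacian G μ w u x := by
  simp [graphLaplacian]

lemma graphLaplacian_const (c : ℝ) (x : V) :
    graphLaplacian G μ w (fun _ => c) x = 0 := by
  simp [graphLaplacian]

lemma continuous_graphLaplacian : Continuous (graphLaplacian G μ w) := by
  unfold graphLaplacian
  fun_prop

/-- Green's formula. -/
lemma sum_mul_graphLaplacian_mul (hμ : ∀ x, 0 < μ x)
    (hs : ∀ x y, G.Adj x y → w x y = w y x) (u v : V → ℝ) :
    ∑ x, μ x * graphLaplacian G μ w u x * v x = - dirichletForm G w u v := by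
  have h1 : ∑ x, μ x * graphLaplacian G μ w u x * v x
      = ∑ x, ∑ y, edgeWeight G w x y * (u y - u x) * v x := by
    refine Finset.sum_congr rfl fun x _ => ?_
    rw [mul_graphLaplacian hμ, Finset.sum_mul]
  have h2 : ∑ x, ∑ y, edgeWeight G w x y * (u y - u x) * v x
      = ∑ x, ∑ y, edgeWeight G w x y * (u x - u y) * v y := by
    rw [Finset.sum_comm]
    refine Finset.sum_congr rfl fun x _ => Finset.sum_congr rfl fun y _ => ?_
    rw [edgeWeight_symm hs]
  have h3 : 2 * dirichletForm G w u v
      = - ∑ x, ∑ y, edgeWeight G w x y * (u y - u x) * v x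
        - ∑ x, ∑ y, edgeWeight G w x y * (u x - u y) * v y := by
    unfold dirichletForm
    rw [← mul_assoc, mul_one_div_cancel two_ne_zero, one_mul, ← Finset.sum_neg_distrib,
      ← Finset.sum_sub_distrib]
    refine Finset.sum_congr rfl fun x _ => ?_
    rw [← Finset.sum_neg_distrib, ← Finset.sum_sub_distrib]
    exact Finset.sum_congr rfl fun y _ => by ring
  rw [h1]
  linarith

lemma sum_mul_graphLaplacian (hμ : ∀ x, 0 < μ x)
    (hs : ∀ x y, G.Adj x y → w x y = w y x) (u : V → ℝ) :
    ∑ x, μ x * graphLaplacian G μ w u x = 0 := by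
  have := sum_mul_graphLaplacian_mul hμ hs u (fun _ => (1 : ℝ))
  simpa [dirichletForm] using this

lemma dirichletForm_self_nonneg (hw : ∀ x y, G.Adj x y → 0 < w x y) (u : V → ℝ) :
    0 ≤ dirichletForm G w u u := by
  unfold dirichletForm
  exact mul_nonneg (by norm_num) (Finset.sum_nonneg fun x _ => Finset.sum_nonneg fun y _ =>
    mul_nonneg (edgeWeight_nonneg hw x y) (mul_self_nonneg _))

lemma dirichletForm_add_self (u d : V → ℝ) :
    dirichletForm G w (u + d) (u + d)
      = dirichletForm G w u u + 2 * dirichletForm G w u d + dirichletForm G w d d := by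
  simp only [dirichletForm, Finset.mul_sum, ← Finset.sum_add_distrib, Pi.add_apply]
  exact Finset.sum_congr rfl fun x _ => Finset.sum_congr rfl fun y _ => by ring

/-- The weighted degrees are bounded relative to the vertex measure. -/
lemma exists_degree_bound (hμ : ∀ x, 0 < μ x) (hw : ∀ x y, G.Adj x y → 0 < w x y) :
    ∃ B, 0 ≤ B ∧ ∀ x, ∑ y, edgeWeight G w x y ≤ B * μ x := by
  have h0 : ∀ x, 0 ≤ (∑ y, edgeWeight G w x y) / μ x := fun x =>
    div_nonneg (Finset.sum_nonneg fun y _ => edgeWeight_nonneg hw x y) (hμ x).le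
  refine ⟨∑ x, (∑ y, edgeWeight G w x y) / μ x, Finset.sum_nonneg fun x _ => h0 x, fun x => ?_⟩
  rw [← div_le_iff₀ (hμ x)]
  exact Finset.single_le_sum (f := fun x => (∑ y, edgeWeight G w x y) / μ x)
    (fun x _ => h0 x) (Finset.mem_univ x)

lemma dirichletForm_self_le (hw : ∀ x y, G.Adj x y → 0 < w x y)
    (hs : ∀ x y, G.Adj x y → w x y = w y x) {B : ℝ}
    (hB : ∀ x, ∑ y, edgeWeight G w x y ≤ B * μ x) (d : V → ℝ) :
    dirichletForm G w d d ≤ 2 * B * ∑ x, μ x * d x ^ 2 := by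
  have h1 : dirichletForm G w d d
      ≤ (∑ x, ∑ y, edgeWeight G w x y * d x ^ 2) + ∑ x, ∑ y, edgeWeight G w x y * d y ^ 2 := by
    simp only [dirichletForm, Finset.mul_sum, ← Finset.sum_add_distrib]
    refine Finset.sum_le_sum fun x _ => Finset.sum_le_sum fun y _ => ?_
    have := mul_nonneg (edgeWeight_nonneg hw x y) (sq_nonneg (d y + d x))
    nlinarith
  have h2 : ∑ x, ∑ y, edgeWeight G w x y * d y ^ 2 = ∑ x, ∑ y, edgeWeight G w x y * d x ^ 2 := by
    rw [Finset.sum_comm]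
    refine Finset.sum_congr rfl fun x _ => Finset.sum_congr rfl fun y _ => ?_
    rw [edgeWeight_symm hs]
  have h3 : ∑ x, ∑ y, edgeWeight G w x y * d x ^ 2 ≤ B * ∑ x, μ x * d x ^ 2 := by
    rw [Finset.mul_sum]
    refine Finset.sum_le_sum fun x _ => ?_
    rw [← Finset.sum_mul, ← mul_assoc]
    exact mul_le_mul_of_nonneg_right (hB x) (sq_nonneg _)
  linarith

/-- A Poincaré inequality: on a connected graph the Dirichlet energy controls the oscillation. -/
lemma exists_poincare (hG : G.Connected) (hw : ∀ x y, G.Adj x y → 0 < w x y) :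
    ∃ C, 0 < C ∧ ∀ (u : V → ℝ) (x y : V), (u x - u y) ^ 2 ≤ C * dirichletForm G w u u := by
  have hpair : ∀ x y : V, ∃ C, 0 ≤ C ∧
      ∀ u : V → ℝ, (u x - u y) ^ 2 ≤ C * dirichletForm G w u u := by
    intro x y
    obtain ⟨p⟩ := hG.preconnected x y
    induction p with
    | nil => exact ⟨0, le_rfl, fun u => by simp⟩
    | @cons x y z hadj p ih =>
      obtain ⟨C, hC0, hC⟩ := ih
      have hwxy := hw x y hadj
      refine ⟨4 / w x y + 2 * C, by positivity, fun u => ?_⟩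
      have hedge : w x y * (u x - u y) ^ 2 ≤ 2 * dirichletForm G w u u := by
        have hn : ∀ a b, 0 ≤ edgeWeight G w a b * ((u b - u a) * (u b - u a)) := fun a b =>
          mul_nonneg (edgeWeight_nonneg hw a b) (mul_self_nonneg _)
        have h1 := Finset.single_le_sum
          (f := fun b => edgeWeight G w x b * ((u b - u x) * (u b - u x)))
          (fun b _ => hn x b) (Finset.mem_univ y)
        have h2 := Finset.single_le_sum
          (f := fun a => ∑ b, edgeWeight G w a b * ((u b - u a) * (u b - u a)))
          (fun a _ => Finset.sum_nonneg fun b _ => hn a b) (Finset.mem_univ x)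
        have h3 : edgeWeight G w x y = w x y := by simp [edgeWeight, hadj]
        simp only [h3] at h1 h2
        unfold dirichletForm
        nlinarith
      have hedge' : (u x - u y) ^ 2 ≤ 2 / w x y * dirichletForm G w u u := by
        rw [div_mul_eq_mul_div, le_div_iff₀ hwxy]
        linarith
      have h4 : 4 / w x y * dirichletForm G w u u
          = 2 * (2 / w x y * dirichletForm G w u u) := by ring
      have h5 := hC u
      nlinarith [sq_nonneg ((u x - u y) - (u y - u z))]
  choose C hC0 hC using hpair
  have hS : ∀ x y, C x y ≤ ∑ a, ∑ b, C a b := fun x y =>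
    (Finset.single_le_sum (f := fun b => C x b) (fun b _ => hC0 x b) (Finset.mem_univ y)).trans
      (Finset.single_le_sum (f := fun a => ∑ b, C a b)
        (fun a _ => Finset.sum_nonneg fun b _ => hC0 a b) (Finset.mem_univ x))
  have hS0 : 0 ≤ ∑ a, ∑ b, C a b := Finset.sum_nonneg fun a _ => Finset.sum_nonneg fun b _ => hC0 a b
  refine ⟨1 + ∑ a, ∑ b, C a b, by linarith, fun u x y => (hC x y u).trans ?_⟩
  exact mul_le_mul_of_nonneg_right (by linarith [hS x y]) (dirichletForm_self_nonneg hw u)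

/-- The Poisson equation `Δv = f - f̄` is solvable, `f̄` being the mean of `f`: the linear map
`v ↦ Δv - ∫ v` is injective on a connected graph, hence surjective. -/
lemma exists_poisson (hG : G.Connected) (hμ : ∀ x, 0 < μ x)
    (hw : ∀ x y, G.Adj x y → 0 < w x y) (hs : ∀ x y, G.Adj x y → w x y = w y x) (f : V → ℝ) :
    ∃ v : V → ℝ, ∀ x, graphLaplacian G μ w v x = f x - vertexIntegral μ f / ∑ x, μ x := by
  have hne := hG.nonempty
  have hvol : 0 < ∑ x, μ x := Finset.sum_pos (fun x _ => hμ x) Finset.univ_nonempty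
  let T : (V → ℝ) →ₗ[ℝ] (V → ℝ) :=
    { toFun := fun u x => graphLaplacian G μ w u x - vertexIntegral μ u
      map_add' := fun u v => by
        funext x
        simp only [graphLaplacian, vertexIntegral, Pi.add_apply, mul_add, Finset.sum_add_distrib,
          mul_sub, Finset.sum_sub_distrib]
        ring
      map_smul' := fun c u => by
        funext x
        simp only [graphLaplacian, vertexIntegral, Pi.smul_apply, smul_eq_mul, RingHom.id_apply]
        rw [mul_sub]
        simp only [Finset.mul_sum]
        congr 1 <;> exact Finset.sum_congr rfl fun y _ => by ring }
  -- integrating `Δu - ∫ u = k` determines `∫ u`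
  have hint : ∀ (u k : V → ℝ), (∀ x, graphLaplacian G μ w u x - vertexIntegral μ u = k x) →
      vertexIntegral μ u = - (vertexIntegral μ k / ∑ x, μ x) := by
    intro u k h
    have h1 : vertexIntegral μ k = - (vertexIntegral μ u * ∑ x, μ x) := by
      have h2 : vertexIntegral μ k = ∑ x, (μ x * graphLaplacian G μ w u x
          - vertexIntegral μ u * μ x) := by
        conv_lhs => unfold vertexIntegral
        exact Finset.sum_congr rfl fun x _ => by rw [← h x]; ring
      rw [h2, Finset.sum_sub_distrib, sum_mul_graphLaplacian hμ hs, ← Finset.mul_sum]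
      ring
    rw [h1]
    field_simp
  have hinj : Function.Injective T := by
    rw [injective_iff_map_eq_zero]
    intro u hu
    have hu' : ∀ x, graphLaplacian G μ w u x - vertexIntegral μ u = 0 := fun x => congrFun hu x
    have h0 : vertexIntegral μ u = 0 := by
      rw [hint u (fun _ => 0) hu']
      simp [vertexIntegral]
    have hlap : ∀ x, graphLaplacian G μ w u x = 0 := fun x => by simpa [h0] using hu' x
    have hE : dirichletForm G w u u = 0 := by
      have := sum_mul_graphLaplacian_mul hμ hs u u
      simp only [hlap, mul_zero, zero_mul, Finset.sum_const_zero] at this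
      linarith
    obtain ⟨C, -, hC⟩ := exists_poincare hG hw
    have hconst : ∀ x y, u x = u y := fun x y => by
      have := hC u x y
      rw [hE, mul_zero] at this
      nlinarith [sq_nonneg (u x - u y), pow_eq_zero_iff (two_ne_zero) |>.1
        (le_antisymm this (sq_nonneg _))]
    funext x
    have h1 : vertexIntegral μ u = u x * ∑ y, μ y := by
      unfold vertexIntegral
      rw [Finset.mul_sum]
      exact Finset.sum_congr rfl fun y _ => by rw [hconst y x]; ring
    rw [h0] at h1
    simpa [hvol.ne'] using h1.symm
  obtain ⟨v, hv⟩ := (LinearMap.injective_iff_surjective.1 hinj) f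
  have hv' : ∀ x, graphLaplacian G μ w v x - vertexIntegral μ v = f x := fun x => congrFun hv x
  refine ⟨v, fun x => ?_⟩
  have := hint v f hv'
  linarith [hv' x]

end Laplacian

/-! ### Order-preserving descent and sub- and supersolutions -/

section Descent

variable {V : Type*} [Fintype V] (G : SimpleGraph V) [DecidableRel G.Adj]

/-- One explicit Euler step of size `τ` for the parabolic flow `∂ₜu = Δu - g(u) - f`, which is the
gradient flow of `energy`. -/
noncomputable def flowStep (μ : V → ℝ) (w : V → V → ℝ) (g : ℝ → ℝ) (f : V → ℝ) (τ : ℝ)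
    (u : V → ℝ) (x : V) : ℝ :=
  u x + τ * (graphLaplacian G μ w u x - g (u x) - f x)

/-- The energy `½ ∫ |∇u|² + ∫ (g̃(u) + f u)` with `g̃(s) = ∫₀ˢ g`, whose critical points are the
solutions of `Δu = g(u) + f`. -/
noncomputable def energy (μ : V → ℝ) (w : V → V → ℝ) (g : ℝ → ℝ) (f : V → ℝ) (u : V → ℝ) : ℝ :=
  (1 / 2) * dirichletForm G w u u + ∑ x, μ x * ((∫ s in (0 : ℝ)..u x, g s) + f x * u x)

variable {G} {μ : V → ℝ} {w : V → V → ℝ} {g : ℝ → ℝ} {f : V → ℝ} {τ : ℝ}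

lemma continuous_flowStep (hg : Continuous g) : Continuous (flowStep G μ w g f τ) := by
  refine continuous_pi fun x => ?_
  have h1 : Continuous fun u : V → ℝ => graphLaplacian G μ w u x :=
    (continuous_apply x).comp continuous_graphLaplacian
  unfold flowStep
  fun_prop

lemma continuous_energy (hg : Continuous g) : Continuous (energy G μ w g f) := by
  have h1 : Continuous fun t : ℝ => ∫ s in (0 : ℝ)..t, g s :=
    intervalIntegral.continuous_primitive (fun a b => hg.intervalIntegrable a b) 0
  unfold energy dirichletForm
  refine Continuous.add (by fun_prop) (continuous_finsetSum _ fun x _ => ?_)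
  exact continuous_const.mul ((h1.comp (continuous_apply x)).add (by fun_prop))

lemma graphLaplacian_eq_of_flowStep_eq (hτ : 0 < τ) {u : V → ℝ}
    (h : flowStep G μ w g f τ u = u) (x : V) :
    graphLaplacian G μ w u x = g (u x) + f x := by
  have := congrFun h x
  simp only [flowStep, add_eq_left, mul_eq_zero, hτ.ne', false_or] at this
  linarith

/-- For small step size the Euler step preserves order: a discrete comparison principle. -/
lemma flowStep_mono (hμ : ∀ x, 0 < μ x) (hw : ∀ x y, G.Adj x y → 0 < w x y) {B K : ℝ}
    (hB : ∀ x, ∑ y, edgeWeight G w x y ≤ B * μ x) (hg : ∀ s t, |g s - g t| ≤ K * |s - t|)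
    (hτ : 0 ≤ τ) (hτ1 : τ * (B + K + 1) ≤ 1) : Monotone (flowStep G μ w g f τ) := by
  intro u v huv x
  have hd : 0 ≤ v x - u x := sub_nonneg.2 (huv x)
  have h1 : graphLaplacian G μ w v x - graphLaplacian G μ w u x ≥ - B * (v x - u x) := by
    have h2 : - (B * μ x) * (v x - u x) ≤ μ x * (graphLaplacian G μ w v x
        - graphLaplacian G μ w u x) := by
      rw [mul_sub (μ x), mul_graphLaplacian hμ, mul_graphLaplacian hμ, ← Finset.sum_sub_distrib]
      calc - (B * μ x) * (v x - u x) ≤ - (∑ y, edgeWeight G w x y) * (v x - u x) := by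
            nlinarith [hB x]
        _ = ∑ y, - (edgeWeight G w x y * (v x - u x)) := by
            rw [neg_mul, Finset.sum_mul, Finset.sum_neg_distrib]
        _ ≤ _ := Finset.sum_le_sum fun y _ => by
            have := mul_nonneg (edgeWeight_nonneg hw x y) (sub_nonneg.2 (huv y))
            linarith
    have h3 : μ x * (- B * (v x - u x)) ≤ μ x * (graphLaplacian G μ w v x
        - graphLaplacian G μ w u x) := by linarith
    exact le_of_mul_le_mul_left h3 (hμ x)
  have h4 : g (v x) - g (u x) ≤ K * (v x - u x) := by
    have := (le_abs_self _).trans (hg (v x) (u x))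
    rwa [abs_of_nonneg hd] at this
  have h5 : τ * (- (B + K) * (v x - u x)) ≤ τ * ((graphLaplacian G μ w v x - g (v x) - f x)
      - (graphLaplacian G μ w u x - g (u x) - f x)) :=
    mul_le_mul_of_nonneg_left (by linarith) hτ
  have h6 : τ * (B + K) * (v x - u x) ≤ 1 * (v x - u x) :=
    mul_le_mul_of_nonneg_right (by linarith) hd
  unfold flowStep
  linarith

lemma integral_sub_linear_le {K : ℝ} (hgc : Continuous g) (hK : 0 ≤ K)
    (hg : ∀ s t, |g s - g t| ≤ K * |s - t|) (a d : ℝ) :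
    (∫ s in (0 : ℝ)..(a + d), g s) - (∫ s in (0 : ℝ)..a, g s) - g a * d ≤ K * d ^ 2 := by
  have hi : ∀ a b : ℝ, IntervalIntegrable g MeasureTheory.volume a b :=
    fun a b => hgc.intervalIntegrable a b
  have h1 : (∫ s in (0 : ℝ)..(a + d), g s) - (∫ s in (0 : ℝ)..a, g s) - g a * d
      = ∫ s in a..(a + d), (g s - g a) := by
    rw [intervalIntegral.integral_interval_sub_left (hi _ _) (hi _ _),
      intervalIntegral.integral_sub (hi _ _) intervalIntegrable_const,
      intervalIntegral.integral_const]
    simp [mul_comm]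
  have h2 : ‖∫ s in a..(a + d), (g s - g a)‖ ≤ K * |d| * |a + d - a| := by
    refine intervalIntegral.norm_integral_le_of_norm_le_const fun s hs => ?_
    refine (hg s a).trans (mul_le_mul_of_nonneg_left ?_ hK)
    have := Set.abs_sub_left_of_mem_uIcc (Set.uIoc_subset_uIcc hs)
    simpa using this
  rw [h1]
  refine (le_abs_self _).trans (h2.trans (le_of_eq ?_))
  rw [add_sub_cancel_left, mul_assoc, ← sq, sq_abs]

/-- The Euler step decreases the energy by at least the squared length of the step. -/
lemma energy_flowStep_le (hμ : ∀ x, 0 < μ x) (hw : ∀ x y, G.Adj x y → 0 < w x y)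
    (hs : ∀ x y, G.Adj x y → w x y = w y x) {B K : ℝ} (hK : 0 ≤ K)
    (hB : ∀ x, ∑ y, edgeWeight G w x y ≤ B * μ x) (hgc : Continuous g)
    (hg : ∀ s t, |g s - g t| ≤ K * |s - t|)
    (hτ : 0 < τ) (hτ1 : τ * (B + K + 1) ≤ 1) (u : V → ℝ) :
    energy G μ w g f (flowStep G μ w g f τ u)
      ≤ energy G μ w g f u - ∑ x, μ x * (flowStep G μ w g f τ u x - u x) ^ 2 := by
  set d : V → ℝ := fun x => flowStep G μ w g f τ u x - u x with hd
  have hstep : flowStep G μ w g f τ u = u + d := by funext x; simp [hd]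
  have hdx : ∀ x, d x = τ * (graphLaplacian G μ w u x - g (u x) - f x) := fun x => by
    simp [hd, flowStep]
  have h1 := dirichletForm_self_le hw hs hB d
  have h2 := sum_mul_graphLaplacian_mul hμ hs u d
  -- the first variation of the energy in the direction `d` is `-‖d‖² / τ`
  have h3 : ∑ x, μ x * ((∫ s in (0 : ℝ)..(u x + d x), g s) + f x * (u x + d x))
      ≤ ∑ x, μ x * ((∫ s in (0 : ℝ)..u x, g s) + f x * u x)
        + ∑ x, μ x * graphLaplacian G μ w u x * d x
        - (B + 1) * ∑ x, μ x * d x ^ 2 := by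
    rw [Finset.mul_sum, ← Finset.sum_add_distrib, ← Finset.sum_sub_distrib]
    refine Finset.sum_le_sum fun x _ => ?_
    have h4 := integral_sub_linear_le hgc hK hg (u x) (d x)
    have h5 : (B + K + 1) * d x ^ 2 ≤ (graphLaplacian G μ w u x - g (u x) - f x) * d x := by
      have h6 : (graphLaplacian G μ w u x - g (u x) - f x) * d x
          = τ * (graphLaplacian G μ w u x - g (u x) - f x) ^ 2 := by rw [hdx]; ring
      have h7 : (B + K + 1) * d x ^ 2 = (τ * (B + K + 1)) *
          (τ * (graphLaplacian G μ w u x - g (u x) - f x) ^ 2) := by rw [hdx]; ring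
      rw [h6, h7]
      exact mul_le_of_le_one_left (mul_nonneg hτ.le (sq_nonneg _)) hτ1
    have h8 := mul_le_mul_of_nonneg_left (add_le_add h4 h5) (hμ x).le
    linarith
  rw [hstep]
  unfold energy
  rw [dirichletForm_add_self]
  simp only [Pi.add_apply, add_sub_cancel_left]
  linarith

/-- The method of sub- and supersolutions, in the order `a ≤ b`. -/
lemma exists_solution_between (hμ : ∀ x, 0 < μ x) (hw : ∀ x y, G.Adj x y → 0 < w x y)
    {K : ℝ} (hK : 0 ≤ K) (hgc : Continuous g) (hg : ∀ s t, |g s - g t| ≤ K * |s - t|)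
    {a b : V → ℝ} (hab : a ≤ b) (ha : ∀ x, g (a x) + f x ≤ graphLaplacian G μ w a x)
    (hb : ∀ x, graphLaplacian G μ w b x ≤ g (b x) + f x) :
    ∃ u : V → ℝ, a ≤ u ∧ u ≤ b ∧ ∀ x, graphLaplacian G μ w u x = g (u x) + f x := by
  obtain ⟨B, hB0, hB⟩ := exists_degree_bound hμ hw
  have hpos : 0 < B + K + 1 := by positivity
  set P := flowStep G μ w g f (1 / (B + K + 1)) with hP
  have hτ : 0 < 1 / (B + K + 1) := by positivity
  have hmono : Monotone P := flowStep_mono hμ hw hB hg hτ.le (by field_simp; rfl)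
  have haP : a ≤ P a := fun x => by
    have := mul_nonneg hτ.le (sub_nonneg.2 (ha x))
    simp only [hP, flowStep]
    linarith
  have hPb : P b ≤ b := fun x => by
    have := mul_nonneg hτ.le (sub_nonneg.2 (hb x))
    simp only [hP, flowStep]
    linarith
  have hseq : Monotone fun n => P^[n] a := hmono.monotone_iterate_of_le_map haP
  have hle : ∀ n, P^[n] a ≤ b := fun n => by
    induction n with
    | zero => exact hab
    | succ n ih =>
      rw [Function.iterate_succ_apply']
      exact (hmono ih).trans hPb
  have hlim : ∀ x, Filter.Tendsto (fun n => P^[n] a x) Filter.atTop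
      (nhds (⨆ n, P^[n] a x)) := fun x =>
    tendsto_atTop_ciSup (fun m n hmn => hseq hmn x) ⟨b x, by rintro _ ⟨n, rfl⟩; exact hle n x⟩
  have hlim' := tendsto_pi_nhds.2 hlim
  have hfix := isFixedPt_of_tendsto_iterate hlim'
    (continuous_flowStep (G := G) (μ := μ) (w := w) (f := f) hgc).continuousAt
  refine ⟨_, ?_, ?_, graphLaplacian_eq_of_flowStep_eq hτ hfix⟩
  · exact ge_of_tendsto' hlim' fun n => hseq (Nat.zero_le n)
  · exact le_of_tendsto' hlim' hle

/-- A solution above a strict subsolution does not touch it. -/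
lemma lt_of_le_of_strict_sub (hμ : ∀ x, 0 < μ x) (hw : ∀ x y, G.Adj x y → 0 < w x y)
    {a u : V → ℝ} (hau : a ≤ u) (ha : ∀ x, g (a x) + f x < graphLaplacian G μ w a x)
    (hu : ∀ x, graphLaplacian G μ w u x = g (u x) + f x) (x : V) : a x < u x := by
  refine lt_of_le_of_ne (hau x) fun h => ?_
  have h1 : μ x * graphLaplacian G μ w a x ≤ μ x * graphLaplacian G μ w u x := by
    rw [mul_graphLaplacian hμ, mul_graphLaplacian hμ]
    exact Finset.sum_le_sum fun y _ => mul_le_mul_of_nonneg_left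
      (by linarith [hau y]) (edgeWeight_nonneg hw x y)
  have h2 := le_of_mul_le_mul_left h1 (hμ x)
  have h3 := ha x
  rw [hu x, ← h] at h2
  linarith

/-- A solution below a strict supersolution does not touch it. -/
lemma lt_of_le_of_strict_super (hμ : ∀ x, 0 < μ x) (hw : ∀ x y, G.Adj x y → 0 < w x y)
    {b u : V → ℝ} (hub : u ≤ b) (hb : ∀ x, graphLaplacian G μ w b x < g (b x) + f x)
    (hu : ∀ x, graphLaplacian G μ w u x = g (u x) + f x) (x : V) : u x < b x := by
  refine lt_of_le_of_ne (hub x) fun h => ?_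
  have h1 : μ x * graphLaplacian G μ w u x ≤ μ x * graphLaplacian G μ w b x := by
    rw [mul_graphLaplacian hμ, mul_graphLaplacian hμ]
    exact Finset.sum_le_sum fun y _ => mul_le_mul_of_nonneg_left
      (by linarith [hub y]) (edgeWeight_nonneg hw x y)
  have h2 := le_of_mul_le_mul_left h1 (hμ x)
  have h3 := hb x
  rw [hu x, h] at h2
  linarith

/-- If `g` is bounded, then sublevel sets of the energy are bounded among the functions that are
neither everywhere below `b` nor everywhere above `a`: the Dirichlet energy grows quadratically with
the oscillation, the other terms only linearly. -/
lemma exists_bound_of_energy_le (hG : G.Connected) (hμ : ∀ x, 0 < μ x)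
    (hw : ∀ x y, G.Adj x y → 0 < w x y) {M : ℝ} (hM : ∀ s, |g s| ≤ M)
    (a b : V → ℝ) (J : ℝ) :
    ∃ ρ, 0 ≤ ρ ∧ ∀ u : V → ℝ, energy G μ w g f u ≤ J → (∃ x, b x ≤ u x) → (∃ y, u y ≤ a y) →
      ∀ p, |u p| ≤ ρ := by
  obtain ⟨C, hC0, hC⟩ := exists_poincare hG hw
  have hM0 : 0 ≤ M := (abs_nonneg _).trans (hM 0)
  set N := ∑ x, (|a x| + |b x|) with hN
  set Q := ∑ x, μ x * (M + |f x|) with hQ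
  set α := 2 * C * (J + Q * N) with hα
  set β := 2 * C * Q with hβ
  have hQ0 : 0 ≤ Q := Finset.sum_nonneg fun x _ =>
    mul_nonneg (hμ x).le (add_nonneg hM0 (abs_nonneg _))
  have hNx : ∀ x, |a x| + |b x| ≤ N := fun x =>
    Finset.single_le_sum (f := fun x => |a x| + |b x|) (fun x _ => by positivity)
      (Finset.mem_univ x)
  have hβ0 : 0 ≤ β := by positivity
  have hN0 : 0 ≤ N := Finset.sum_nonneg fun x _ => by positivity
  refine ⟨N + (1 + |α| + β), by positivity, fun u hJ ⟨x, hx⟩ ⟨y, hy⟩ => ?_⟩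
  set E := dirichletForm G w u u with hE
  have hE0 : 0 ≤ E := dirichletForm_self_nonneg hw u
  set r := Real.sqrt (C * E) with hr
  have hr0 : 0 ≤ r := Real.sqrt_nonneg _
  have hr2 : r ^ 2 = C * E := Real.sq_sqrt (mul_nonneg hC0.le hE0)
  have hosc : ∀ p q, u p - u q ≤ r := fun p q => (abs_le.1 (Real.abs_le_sqrt (hC u p q))).2
  have hup : ∀ p, |u p| ≤ N + r := fun p => by
    rw [abs_le]
    constructor
    · have := neg_abs_le (b x)
      linarith [hosc x p, hNx x, abs_nonneg (a x)]
    · have := le_abs_self (a y)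
      linarith [hosc p y, hNx y, abs_nonneg (b y)]
  have hlow : - (Q * (N + r)) ≤ ∑ x, μ x * ((∫ s in (0 : ℝ)..u x, g s) + f x * u x) := by
    rw [hQ, Finset.sum_mul, ← Finset.sum_neg_distrib]
    refine Finset.sum_le_sum fun p _ => ?_
    have h1 : |∫ s in (0 : ℝ)..u p, g s| ≤ M * |u p| := by
      simpa using intervalIntegral.norm_integral_le_of_norm_le_const
        (a := (0 : ℝ)) (b := u p) (f := g) (C := M) fun s _ => hM s
    have h2 : |f p * u p| = |f p| * |u p| := abs_mul _ _
    have h3 : (M + |f p|) * |u p| ≤ (M + |f p|) * (N + r) :=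
      mul_le_mul_of_nonneg_left (hup p) (add_nonneg hM0 (abs_nonneg _))
    have h4 : - ((M + |f p|) * (N + r)) ≤ (∫ s in (0 : ℝ)..u p, g s) + f p * u p := by
      have := neg_abs_le (∫ s in (0 : ℝ)..u p, g s)
      have := neg_abs_le (f p * u p)
      linarith
    have := mul_le_mul_of_nonneg_left h4 (hμ p).le
    linarith
  have hquad : r ^ 2 ≤ α + β * r := by
    have h1 : (1 / 2) * E ≤ J + Q * (N + r) := by
      unfold energy at hJ
      linarith
    have h2 := mul_le_mul_of_nonneg_left h1 (by positivity : (0 : ℝ) ≤ 2 * C)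
    rw [hr2, hα, hβ]
    linarith
  have hrb : r ≤ 1 + |α| + β := by
    by_contra! h
    have h1 := mul_lt_mul_of_pos_left h (by linarith [abs_nonneg α] : 0 < r)
    have h2 : |α| * 1 ≤ |α| * r :=
      mul_le_mul_of_nonneg_left (by linarith [abs_nonneg α]) (abs_nonneg α)
    linarith [le_abs_self α]
  exact fun p => (hup p).trans (by linarith)

/-- The LaSalle principle for the Euler step: a bounded orbit accumulates at a fixed point. -/
lemma exists_fixedPoint_mem_closure (hμ : ∀ x, 0 < μ x) {P : (V → ℝ) → (V → ℝ)}
    {J : (V → ℝ) → ℝ} (hP : Continuous P) (hJ : Continuous J)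
    (hdesc : ∀ u, J (P u) ≤ J u - ∑ x, μ x * (P u x - u x) ^ 2)
    {u₀ : V → ℝ} {ρ : ℝ} (hρ0 : 0 ≤ ρ) (hρ : ∀ n x, |P^[n] u₀ x| ≤ ρ) :
    ∃ u, P u = u ∧ u ∈ closure (Set.range fun n => P^[n] u₀) := by
  have hnn : ∀ u, 0 ≤ ∑ x, μ x * (P u x - u x) ^ 2 := fun u =>
    Finset.sum_nonneg fun x _ => mul_nonneg (hμ x).le (sq_nonneg _)
  have hanti : Antitone fun n => J (P^[n] u₀) := antitone_nat_of_succ_le fun n => by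
    rw [Function.iterate_succ_apply']
    linarith [hdesc (P^[n] u₀), hnn (P^[n] u₀)]
  have hmem : ∀ n, P^[n] u₀ ∈ Metric.closedBall (0 : V → ℝ) ρ := fun n => by
    refine mem_closedBall_zero_iff.2 (pi_norm_le_iff_of_nonneg hρ0 |>.2 fun x => hρ n x)
  obtain ⟨u, -, φ, hφ, hlim⟩ := tendsto_subseq_of_bounded Metric.isBounded_closedBall hmem
  have hJlim : Filter.Tendsto (fun n => J (P^[φ n] u₀)) Filter.atTop (nhds (J u)) :=
    (hJ.tendsto u).comp hlim
  have hge : ∀ n, J u ≤ J (P^[n] u₀) := fun n =>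
    le_of_tendsto hJlim (Filter.eventually_atTop.2 ⟨n, fun m hm =>
      hanti (hm.trans (hφ.id_le m))⟩)
  have hJP : J u ≤ J (P u) :=
    ge_of_tendsto' (((hJ.comp hP).tendsto u).comp hlim) fun n => by
      have := hge (φ n + 1)
      rwa [Function.iterate_succ_apply'] at this
  have hzero : ∑ x, μ x * (P u x - u x) ^ 2 = 0 :=
    le_antisymm (by linarith [hdesc u]) (hnn u)
  refine ⟨u, funext fun x => ?_, mem_closure_of_tendsto hlim
    (Filter.Eventually.of_forall fun n => ⟨φ n, rfl⟩)⟩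
  have := (Finset.sum_eq_zero_iff_of_nonneg fun x _ =>
    mul_nonneg (hμ x).le (sq_nonneg _)).1 hzero x (Finset.mem_univ x)
  simpa [(hμ x).ne', sub_eq_zero] using this

/-- Sub- and supersolutions in the reversed order: a strict supersolution `b` strictly below a strict
subsolution `a` still forces a solution, which is neither everywhere above `a` nor everywhere below
`b`. The orbits starting on the segment from `b` to `a` that ever get below `b` form an open set of
parameters, as do those that ever get above `a`; the segment being connected, some orbit does
neither, and it accumulates at the solution. -/
lemma exists_solution_of_reversed (hG : G.Connected) (hμ : ∀ x, 0 < μ x)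
    (hw : ∀ x y, G.Adj x y → 0 < w x y) (hs : ∀ x y, G.Adj x y → w x y = w y x)
    {K M : ℝ} (hK : 0 ≤ K) (hgc : Continuous g) (hg : ∀ s t, |g s - g t| ≤ K * |s - t|)
    (hM : ∀ s, |g s| ≤ M) {a b : V → ℝ} (hba : ∀ x, b x < a x)
    (ha : ∀ x, g (a x) + f x < graphLaplacian G μ w a x)
    (hb : ∀ x, graphLaplacian G μ w b x < g (b x) + f x) :
    ∃ u : V → ℝ, (∀ x, graphLaplacian G μ w u x = g (u x) + f x) ∧
      (¬ ∀ x, a x < u x) ∧ ¬ ∀ x, u x < b x := by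
  have hne := hG.nonempty
  obtain ⟨B, hB0, hB⟩ := exists_degree_bound hμ hw
  have hpos : 0 < B + K + 1 := by positivity
  set P := flowStep G μ w g f (1 / (B + K + 1)) with hP
  have hτ : 0 < 1 / (B + K + 1) := by positivity
  have hτ1 : 1 / (B + K + 1) * (B + K + 1) ≤ 1 := by field_simp; rfl
  have hmono : Monotone P := flowStep_mono hμ hw hB hg hτ.le hτ1
  have hcont : Continuous P := continuous_flowStep hgc
  have hdesc : ∀ u, energy G μ w g f (P u)
      ≤ energy G μ w g f u - ∑ x, μ x * (P u x - u x) ^ 2 :=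
    energy_flowStep_le hμ hw hs hK hB hgc hg hτ hτ1
  have haP : ∀ x, a x < P a x := fun x => by
    have := mul_pos hτ (sub_pos.2 (ha x))
    simp only [hP, flowStep]
    linarith
  have hPb : ∀ x, P b x < b x := fun x => by
    have := mul_pos hτ (sub_pos.2 (hb x))
    simp only [hP, flowStep]
    linarith
  set U₁ : Set (V → ℝ) := {u | ∀ x, a x < u x} with hU₁
  set U₀ : Set (V → ℝ) := {u | ∀ x, u x < b x} with hU₀
  have hU₁o : IsOpen U₁ := by
    simp only [hU₁, Set.ofPred_forall]
    exact isOpen_iInter_of_finite fun x => isOpen_lt continuous_const (continuous_apply x)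
  have hU₀o : IsOpen U₀ := by
    simp only [hU₀, Set.ofPred_forall]
    exact isOpen_iInter_of_finite fun x => isOpen_lt (continuous_apply x) continuous_const
  have hU₁P : Set.MapsTo P U₁ U₁ := fun u hu x =>
    (haP x).trans_le (hmono (fun y => (hu y).le) x)
  have hU₀P : Set.MapsTo P U₀ U₀ := fun u hu x =>
    (hmono (fun y => (hu y).le) x).trans_lt (hPb x)
  let γ : ℝ → V → ℝ := fun θ x => b x + θ * (a x - b x)
  have hγ : Continuous γ := by fun_prop
  have hγ0 : γ 0 = b := by funext x; simp [γ]
  have hγ1 : γ 1 = a := by funext x; simp [γ]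
  let A₁ : Set ℝ := ⋃ n : ℕ, {θ | P^[n] (γ θ) ∈ U₁}
  let A₀ : Set ℝ := ⋃ n : ℕ, {θ | P^[n] (γ θ) ∈ U₀}
  have hA₁o : IsOpen A₁ := isOpen_iUnion fun n => hU₁o.preimage ((hcont.iterate n).comp hγ)
  have hA₀o : IsOpen A₀ := isOpen_iUnion fun n => hU₀o.preimage ((hcont.iterate n).comp hγ)
  have hdisj : ¬ (A₁ ∩ A₀).Nonempty := by
    rintro ⟨θ, h1, h0⟩
    obtain ⟨n, hn⟩ := Set.mem_iUnion.1 h1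
    obtain ⟨m, hm⟩ := Set.mem_iUnion.1 h0
    have h1' := hU₁P.iterate m hn
    have h0' := hU₀P.iterate n hm
    rw [← Function.iterate_add_apply] at h1' h0'
    rw [add_comm] at h0'
    obtain ⟨x⟩ := hne
    have := h1' x
    have := h0' x
    linarith [hba x]
  obtain ⟨θ, hθ⟩ : ∃ θ, θ ∉ A₁ ∪ A₀ := by
    by_contra! h
    refine hdisj (nonempty_inter hA₁o hA₀o (Set.eq_univ_of_forall h) ⟨1, ?_⟩ ⟨0, ?_⟩)
    · exact Set.mem_iUnion.2 ⟨1, show P (γ 1) ∈ U₁ by rw [hγ1]; exact haP⟩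
    · exact Set.mem_iUnion.2 ⟨1, show P (γ 0) ∈ U₀ by rw [hγ0]; exact hPb⟩
  have h1 : ∀ n, P^[n] (γ θ) ∈ U₁ᶜ := fun n h => hθ (Or.inl (Set.mem_iUnion.2 ⟨n, h⟩))
  have h0 : ∀ n, P^[n] (γ θ) ∈ U₀ᶜ := fun n h => hθ (Or.inr (Set.mem_iUnion.2 ⟨n, h⟩))
  have hen : ∀ n, energy G μ w g f (P^[n] (γ θ)) ≤ energy G μ w g f (γ θ) := fun n => by
    induction n with
    | zero => exact le_rfl
    | succ n ih =>
      rw [Function.iterate_succ_apply']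
      have : 0 ≤ ∑ x, μ x * (P (P^[n] (γ θ)) x - P^[n] (γ θ) x) ^ 2 :=
        Finset.sum_nonneg fun x _ => mul_nonneg (hμ x).le (sq_nonneg _)
      linarith [hdesc (P^[n] (γ θ))]
  obtain ⟨ρ, hρ0, hρ⟩ := exists_bound_of_energy_le (f := f) hG hμ hw hM a b (energy G μ w g f (γ θ))
  obtain ⟨u, hfix, hcl⟩ := exists_fixedPoint_mem_closure (u₀ := γ θ) hμ hcont
    (continuous_energy hgc) hdesc hρ0 fun n => hρ _ (hen n)
      (by simpa [hU₀] using h0 n) (by simpa [hU₁] using h1 n)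
  refine ⟨u, graphLaplacian_eq_of_flowStep_eq hτ hfix, ?_, ?_⟩
  · exact closure_minimal (Set.range_subset_iff.2 h1) hU₁o.isClosed_compl hcl
  · exact closure_minimal (Set.range_subset_iff.2 h0) hU₀o.isClosed_compl hcl

end Descent

/-! ### The nonlinearity -/

section Higgs

/-- The Chern–Simons–Higgs nonlinearity `eˢ (eˢ - 1)`. -/
noncomputable def higgs (s : ℝ) : ℝ := Real.exp s * (Real.exp s - 1)

lemma continuous_higgs : Continuous higgs := by
  unfold higgs
  fun_prop

lemma neg_quarter_le_higgs (s : ℝ) : -(1 / 4) ≤ higgs s := by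
  unfold higgs
  nlinarith [sq_nonneg (Real.exp s - 1 / 2)]

lemma le_higgs {s : ℝ} (hs : 0 ≤ s) : s ≤ higgs s := by
  unfold higgs
  nlinarith [Real.add_one_le_exp s]

lemma abs_higgs_le_exp {s : ℝ} (hs : s ≤ 0) : |higgs s| ≤ Real.exp s := by
  have h0 := Real.exp_pos s
  have h1 := Real.exp_le_one_iff.2 hs
  unfold higgs
  rw [abs_le]
  constructor <;> nlinarith

lemma abs_higgs_le_of_le {s R : ℝ} (hs : s ≤ R) :
    |higgs s| ≤ Real.exp R * (Real.exp R + 1) := by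
  have h0 := Real.exp_pos s
  have h1 := Real.exp_le_exp.2 hs
  unfold higgs
  rw [abs_le]
  constructor <;> nlinarith

/-- The nonlinearity truncated at height `R` is globally Lipschitz. -/
lemma abs_higgs_min_sub_le (R s t : ℝ) :
    |higgs (min s R) - higgs (min t R)|
      ≤ Real.exp R * (2 * Real.exp R + 1) * |s - t| := by
  have key : ∀ a b : ℝ, a ≤ R → |Real.exp a - Real.exp b| ≤ Real.exp R * |a - b| ∨ a ≤ b := by
    intro a b ha
    rcases le_total a b with h | h
    · exact Or.inr h
    · left
      have h1 := Real.add_one_le_exp (b - a)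
      have h2 : Real.exp b = Real.exp a * Real.exp (b - a) := by rw [← Real.exp_add]; ring_nf
      have h3 := Real.exp_le_exp.2 ha
      rw [abs_of_nonneg (sub_nonneg.2 (Real.exp_le_exp.2 h)), abs_of_nonneg (sub_nonneg.2 h), h2]
      nlinarith [Real.exp_pos a]
  have hexp : ∀ a b : ℝ, a ≤ R → b ≤ R →
      |Real.exp a - Real.exp b| ≤ Real.exp R * |a - b| := by
    intro a b ha hb
    rcases key a b ha with h | h
    · exact h
    · rcases key b a hb with h' | h'
      · rwa [abs_sub_comm, abs_sub_comm a b]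
      · simp [le_antisymm h h']
  set a := min s R with ha'
  set b := min t R with hb'
  have ha : a ≤ R := min_le_right _ _
  have hb : b ≤ R := min_le_right _ _
  have hab : |a - b| ≤ |s - t| := by
    have := abs_min_sub_min_le_max s R t R
    simpa using this
  have h1 : higgs a - higgs b
      = (Real.exp a - Real.exp b) * (Real.exp a + Real.exp b - 1) := by
    unfold higgs
    ring
  have h2 : |Real.exp a + Real.exp b - 1| ≤ 2 * Real.exp R + 1 := by
    have := Real.exp_le_exp.2 ha
    have := Real.exp_le_exp.2 hb
    rw [abs_le]
    constructor <;> linarith [Real.exp_pos a, Real.exp_pos b]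
  rw [h1, abs_mul]
  calc |Real.exp a - Real.exp b| * |Real.exp a + Real.exp b - 1|
      ≤ (Real.exp R * |s - t|) * (2 * Real.exp R + 1) :=
        mul_le_mul ((hexp a b ha hb).trans
          (mul_le_mul_of_nonneg_left hab (Real.exp_pos R).le)) h2 (abs_nonneg _) (by positivity)
    _ = _ := by ring

/-- Replacing the parameter `k` by `l` and translating by `log (k / l)` leaves the term `k eˢ`
unchanged and shrinks `k e²ˢ`; hence translates of solutions for `±k` are strict sub- or
supersolutions for `±l`. -/
lemma mul_higgs_lt_mul_higgs_shift {k l : ℝ} (hk : 0 < k) (hkl : k < l) (s : ℝ) :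
    l * higgs (s + Real.log (k / l)) < k * higgs s := by
  have hl : 0 < l := hk.trans hkl
  unfold higgs
  rw [Real.exp_add, Real.exp_log (div_pos hk hl)]
  have h1 : l * (Real.exp s * (k / l) * (Real.exp s * (k / l) - 1))
      = k * (Real.exp s * (Real.exp s * (k / l) - 1)) := by
    field_simp
  have h2 : Real.exp s * (k / l) < Real.exp s * 1 :=
    mul_lt_mul_of_pos_left ((div_lt_one hl).2 hkl) (Real.exp_pos s)
  rw [h1]
  exact mul_lt_mul_of_pos_left (mul_lt_mul_of_pos_left (by linarith) (Real.exp_pos s)) hk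

end Higgs

/-! ### Solvability of the Chern–Simons–Higgs equation -/

section Equation

variable {V : Type*} [Fintype V] {G : SimpleGraph V} [DecidableRel G.Adj]
  {μ : V → ℝ} {w : V → V → ℝ} {f : V → ℝ} {lam : ℝ}

lemma isChernSimonsHiggsSolution_iff {u : V → ℝ} :
    IsChernSimonsHiggsSolution G μ w lam f u
      ↔ ∀ x, graphLaplacian G μ w u x = lam * higgs (u x) + f x := by
  simp only [IsChernSimonsHiggsSolution, higgs, mul_assoc]

lemma mul_sum_higgs (hμ : ∀ x, 0 < μ x) (hs : ∀ x y, G.Adj x y → w x y = w y x)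
    {u v : V → ℝ} (h : ∀ x, graphLaplacian G μ w u x = lam * higgs (v x) + f x) :
    lam * ∑ x, μ x * higgs (v x) = - vertexIntegral μ f := by
  have h1 := sum_mul_graphLaplacian hμ hs u
  have h2 : ∑ x, μ x * graphLaplacian G μ w u x
      = lam * (∑ x, μ x * higgs (v x)) + vertexIntegral μ f := by
    unfold vertexIntegral
    rw [Finset.mul_sum, ← Finset.sum_add_distrib]
    exact Finset.sum_congr rfl fun x _ => by rw [h x]; ring
  linarith

/-- An upper bound from the integrated equation alone, which therefore also applies to truncations
of a solution of the truncated equation. -/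
lemma exists_upper_bound (hμ : ∀ x, 0 < μ x) (f : V → ℝ) {m : ℝ} (hm : 0 < m) :
    ∃ H, ∀ lam : ℝ, m ≤ |lam| → ∀ v : V → ℝ,
      lam * ∑ x, μ x * higgs (v x) = - vertexIntegral μ f → ∀ x, v x ≤ H := by
  set S := |vertexIntegral μ f| / m + ∑ x, μ x with hS
  have hvol : 0 ≤ ∑ x, μ x := Finset.sum_nonneg fun x _ => (hμ x).le
  have hS0 : 0 ≤ S := by positivity
  have hS' : ∀ x, 0 ≤ S / μ x := fun x => div_nonneg hS0 (hμ x).le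
  refine ⟨∑ x, S / μ x, fun lam hlam v hv x => ?_⟩
  have h1 : ∑ x, μ x * higgs (v x) ≤ |vertexIntegral μ f| / m := by
    rw [le_div_iff₀ hm]
    have h2 : |lam| * |∑ x, μ x * higgs (v x)| = |vertexIntegral μ f| := by
      rw [← abs_mul, hv, abs_neg]
    have h3 := mul_le_mul_of_nonneg_right hlam (abs_nonneg (∑ x, μ x * higgs (v x)))
    have h4 := mul_le_mul_of_nonneg_right (le_abs_self (∑ x, μ x * higgs (v x))) hm.le
    linarith
  have h5 : μ x * higgs (v x) ≤ S := by
    have h6 : μ x * (higgs (v x) + 1 / 4) ≤ ∑ x, μ x * (higgs (v x) + 1 / 4) :=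
      Finset.single_le_sum (f := fun x => μ x * (higgs (v x) + 1 / 4))
        (fun y _ => mul_nonneg (hμ y).le (by linarith [neg_quarter_le_higgs (v y)]))
        (Finset.mem_univ x)
    simp only [mul_add, Finset.sum_add_distrib, ← Finset.sum_mul] at h6
    linarith [hμ x]
  have h7 : v x ≤ S / μ x := by
    rcases le_total 0 (v x) with h | h
    · rw [le_div_iff₀ (hμ x)]
      have := mul_le_mul_of_nonneg_left (le_higgs h) (hμ x).le
      linarith
    · exact h.trans (hS' x)
  exact h7.trans (Finset.single_le_sum (f := fun x => S / μ x) (fun y _ => hS' y)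
    (Finset.mem_univ x))

/-- Solutions are bounded uniformly in the parameter, as long as it stays in a bounded set away from
zero. From below, this uses that `eᵘ (eᵘ - 1)` has a nonzero integral, so that `u` cannot be very
negative everywhere, and that its oscillation is bounded. -/
lemma exists_solution_bound (hG : G.Connected) (hμ : ∀ x, 0 < μ x)
    (hw : ∀ x y, G.Adj x y → 0 < w x y) (hs : ∀ x y, G.Adj x y → w x y = w y x)
    (hf : vertexIntegral μ f ≠ 0) {m Λ : ℝ} (hm : 0 < m) :
    ∃ ρ, ∀ lam : ℝ, m ≤ |lam| → |lam| ≤ Λ → ∀ u : V → ℝ,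
      IsChernSimonsHiggsSolution G μ w lam f u → ∀ x, |u x| ≤ ρ := by
  have hne := hG.nonempty
  obtain ⟨H, hH⟩ := exists_upper_bound hμ f hm
  obtain ⟨C, hC0, hC⟩ := exists_poincare hG hw
  obtain ⟨Mf, hMf⟩ := Finite.exists_le fun x => |f x|
  set vol := ∑ x, μ x with hvol
  have hvol0 : 0 < vol := Finset.sum_pos (fun x _ => hμ x) Finset.univ_nonempty
  set K := Λ * (Real.exp H * (Real.exp H + 1)) + Mf with hK
  set r := C * (K * vol) with hr
  set δ := |vertexIntegral μ f| / (Λ * vol) with hδ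
  refine ⟨|H| + |Real.log δ| + |r|, fun lam h1 h2 u hu => ?_⟩
  have hΛ : 0 < Λ := hm.trans_le (h1.trans h2)
  have hδ0 : 0 < δ := div_pos (abs_pos.2 hf) (mul_pos hΛ hvol0)
  rw [isChernSimonsHiggsSolution_iff] at hu
  have hint := mul_sum_higgs hμ hs hu
  have hup := hH lam h1 u hint
  have hlap : ∀ x, |graphLaplacian G μ w u x| ≤ K := fun x => by
    rw [hu x]
    refine (abs_add_le _ _).trans (add_le_add ?_ (hMf x))
    rw [abs_mul]
    exact mul_le_mul h2 (abs_higgs_le_of_le (hup x)) (abs_nonneg _) hΛ.le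
  -- the oscillation of `u` is attained between a maximum `p` and a minimum `q`
  obtain ⟨p, hp⟩ := Finite.exists_max u
  obtain ⟨q, hq⟩ := Finite.exists_min u
  have hosc : u p - u q ≤ r := by
    have h3 : dirichletForm G w u u ≤ K * vol * (u p - u q) := by
      have h4 := sum_mul_graphLaplacian_mul hμ hs u u
      have h5 : - ∑ x, μ x * graphLaplacian G μ w u x * u x
          = ∑ x, μ x * (graphLaplacian G μ w u x * (u p - u x)) := by
        have h6 : ∑ x, μ x * (graphLaplacian G μ w u x * (u p - u x))
            = u p * ∑ x, μ x * graphLaplacian G μ w u x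
              - ∑ x, μ x * graphLaplacian G μ w u x * u x := by
          rw [Finset.mul_sum, ← Finset.sum_sub_distrib]
          exact Finset.sum_congr rfl fun x _ => by ring
        rw [h6, sum_mul_graphLaplacian hμ hs]
        ring
      have h7 : ∑ x, μ x * (graphLaplacian G μ w u x * (u p - u x))
          ≤ ∑ x, μ x * (K * (u p - u q)) := by
        refine Finset.sum_le_sum fun x _ => mul_le_mul_of_nonneg_left ?_ (hμ x).le
        refine (le_abs_self _).trans ?_
        rw [abs_mul, abs_of_nonneg (sub_nonneg.2 (hp x))]
        exact mul_le_mul (hlap x) (by linarith [hq x]) (sub_nonneg.2 (hp x))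
          ((abs_nonneg _).trans (hlap x))
      rw [← Finset.sum_mul] at h7
      linarith
    rcases (sub_nonneg.2 (hq p)).eq_or_lt with h8 | h8
    · have hK0 : 0 ≤ K := (abs_nonneg _).trans (hlap p)
      rw [← h8]
      positivity
    · have h9 := (hC u p q).trans (mul_le_mul_of_nonneg_left h3 hC0.le)
      refine le_of_mul_le_mul_right ?_ h8
      rw [← sq]
      linarith
  have hlow : ∃ x, -|Real.log δ| ≤ u x := by
    by_contra! hcon
    have h3 : |∑ x, μ x * higgs (u x)| < δ * vol := by
      refine (Finset.abs_sum_le_sum_abs _ _).trans_lt ?_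
      rw [hvol, Finset.mul_sum]
      refine Finset.sum_lt_sum_of_nonempty Finset.univ_nonempty fun x _ => ?_
      rw [abs_mul, abs_of_pos (hμ x), mul_comm δ]
      refine mul_lt_mul_of_pos_left ?_ (hμ x)
      have h4 : u x ≤ 0 := (hcon x).le.trans (neg_nonpos.2 (abs_nonneg _))
      refine (abs_higgs_le_exp h4).trans_lt ?_
      rw [← Real.lt_log_iff_exp_lt hδ0]
      exact (hcon x).trans_le (neg_abs_le _)
    have h5 : |lam| * |∑ x, μ x * higgs (u x)| = |vertexIntegral μ f| := by
      rw [← abs_mul, hint, abs_neg]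
    have h6 : Λ * (δ * vol) = |vertexIntegral μ f| := by
      rw [hδ]
      field_simp
    have h7 := mul_le_mul_of_nonneg_right h2 (abs_nonneg (∑ x, μ x * higgs (u x)))
    have h8 := mul_lt_mul_of_pos_left h3 hΛ
    linarith
  obtain ⟨x₀, hx₀⟩ := hlow
  intro x
  rw [abs_le]
  constructor
  · linarith [hp x₀, hq x, le_abs_self r, abs_nonneg H]
  · linarith [hup x, le_abs_self H, abs_nonneg r, abs_nonneg (Real.log δ)]

/-- Sub- and supersolutions for the Chern–Simons–Higgs equation. -/
lemma exists_higgs_solution_between (hμ : ∀ x, 0 < μ x) (hw : ∀ x y, G.Adj x y → 0 < w x y)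
    {a b : V → ℝ} (hab : a ≤ b)
    (ha : ∀ x, lam * higgs (a x) + f x ≤ graphLaplacian G μ w a x)
    (hb : ∀ x, graphLaplacian G μ w b x ≤ lam * higgs (b x) + f x) :
    ∃ u : V → ℝ, a ≤ u ∧ u ≤ b ∧ IsChernSimonsHiggsSolution G μ w lam f u := by
  obtain ⟨R, hR⟩ := Finite.exists_le b
  obtain ⟨u, hau, hub, hu⟩ := exists_solution_between (g := fun s => lam * higgs (min s R))
    (K := |lam| * (Real.exp R * (2 * Real.exp R + 1))) hμ hw (by positivity)
    (continuous_const.mul (continuous_higgs.comp (by fun_prop)))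
    (fun s t => by
      rw [← mul_sub, abs_mul, mul_assoc]
      exact mul_le_mul_of_nonneg_left (abs_higgs_min_sub_le R s t) (abs_nonneg _))
    hab (fun x => by simpa [min_eq_left ((hab x).trans (hR x))] using ha x)
    (fun x => by simpa [min_eq_left (hR x)] using hb x)
  refine ⟨u, hau, hub, isChernSimonsHiggsSolution_iff.2 fun x => ?_⟩
  simpa [min_eq_left ((hub x).trans (hR x))] using hu x

/-- Sub- and supersolutions in the reversed order for the Chern–Simons–Higgs equation. -/
lemma exists_higgs_solution_of_reversed (hG : G.Connected) (hμ : ∀ x, 0 < μ x)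
    (hw : ∀ x y, G.Adj x y → 0 < w x y) (hs : ∀ x y, G.Adj x y → w x y = w y x)
    (hlam : lam ≠ 0) {a b : V → ℝ} (hba : ∀ x, b x < a x)
    (ha : ∀ x, lam * higgs (a x) + f x < graphLaplacian G μ w a x)
    (hb : ∀ x, graphLaplacian G μ w b x < lam * higgs (b x) + f x) :
    ∃ u : V → ℝ, IsChernSimonsHiggsSolution G μ w lam f u ∧
      (¬ ∀ x, a x < u x) ∧ ¬ ∀ x, u x < b x := by
  obtain ⟨R₀, hR₀⟩ := Finite.exists_le a
  obtain ⟨H, hH⟩ := exists_upper_bound hμ f (abs_pos.2 hlam)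
  -- above the a priori bound `H` the truncation is not seen by solutions
  set R := max R₀ (H + 1) with hR
  have haR : ∀ x, a x ≤ R := fun x => (hR₀ x).trans (le_max_left _ _)
  obtain ⟨u, hu, hu1, hu2⟩ := exists_solution_of_reversed (g := fun s => lam * higgs (min s R))
    (K := |lam| * (Real.exp R * (2 * Real.exp R + 1)))
    (M := |lam| * (Real.exp R * (Real.exp R + 1))) hG hμ hw hs (by positivity)
    (continuous_const.mul (continuous_higgs.comp (by fun_prop)))
    (fun s t => by
      rw [← mul_sub, abs_mul, mul_assoc]
      exact mul_le_mul_of_nonneg_left (abs_higgs_min_sub_le R s t) (abs_nonneg _))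
    (fun s => by
      rw [abs_mul]
      exact mul_le_mul_of_nonneg_left (abs_higgs_le_of_le (min_le_right s R)) (abs_nonneg _))
    hba (fun x => by simpa [min_eq_left (haR x)] using ha x)
    (fun x => by simpa [min_eq_left ((hba x).le.trans (haR x))] using hb x)
  refine ⟨u, isChernSimonsHiggsSolution_iff.2 fun x => ?_, hu1, hu2⟩
  have h1 := hH lam le_rfl (fun x => min (u x) R) (mul_sum_higgs hμ hs hu) x
  have h2 : u x ≤ R := by
    by_contra! h
    simp only [min_eq_right h.le] at h1
    linarith [le_max_right R₀ (H + 1)]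
  simpa [min_eq_left h2] using hu x

/-- Very negative solutions of the Poisson equation `Δv = f - f̄`, on which the nonlinearity is
negligible. -/
lemma exists_low_poisson (hG : G.Connected) (hμ : ∀ x, 0 < μ x)
    (hw : ∀ x y, G.Adj x y → 0 < w x y) (hs : ∀ x y, G.Adj x y → w x y = w y x)
    (f : V → ℝ) (lam A : ℝ) {ε : ℝ} (hε : 0 < ε) :
    ∃ v : V → ℝ, (∀ x, v x < A) ∧ (∀ x, |lam * higgs (v x)| < ε) ∧
      ∀ x, graphLaplacian G μ w v x = f x - vertexIntegral μ f / ∑ x, μ x := by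
  obtain ⟨v, hv⟩ := exists_poisson hG hμ hw hs f
  obtain ⟨R, hR⟩ := Finite.exists_le v
  have hδ : 0 < ε / (|lam| + 1) := by positivity
  set T := min (A - 1) (min 0 (Real.log (ε / (|lam| + 1)))) with hT
  have hx : ∀ x, v x + (T - R) ≤ T := fun x => by linarith [hR x]
  refine ⟨fun x => v x + (T - R), fun x => ?_, fun x => ?_, fun x => ?_⟩
  · linarith [hx x, min_le_left (A - 1) (min 0 (Real.log (ε / (|lam| + 1))))]
  · have h1 : v x + (T - R) ≤ 0 := (hx x).trans ((min_le_right _ _).trans (min_le_left _ _))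
    have h2 : v x + (T - R) ≤ Real.log (ε / (|lam| + 1)) :=
      (hx x).trans ((min_le_right _ _).trans (min_le_right _ _))
    have h3 := (abs_higgs_le_exp h1).trans ((Real.le_log_iff_exp_le hδ).1 h2)
    rw [le_div_iff₀ (by positivity)] at h3
    rw [abs_mul]
    rcases (abs_nonneg (higgs (v x + (T - R)))).eq_or_lt with h4 | h4
    · rw [← h4]
      simpa using hε
    · linarith
  · rw [graphLaplacian_add_const, hv x]

/-- Very large solutions of the Poisson equation `Δv = f - f̄`, on which the nonlinearity dominates. -/
lemma exists_high_poisson (hG : G.Connected) (hμ : ∀ x, 0 < μ x)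
    (hw : ∀ x y, G.Adj x y → 0 < w x y) (hs : ∀ x y, G.Adj x y → w x y = w y x)
    (f : V → ℝ) (hlam : 0 < lam) (A N : ℝ) :
    ∃ v : V → ℝ, (∀ x, A < v x) ∧ (∀ x, N < lam * higgs (v x)) ∧
      ∀ x, graphLaplacian G μ w v x = f x - vertexIntegral μ f / ∑ x, μ x := by
  obtain ⟨v, hv⟩ := exists_poisson hG hμ hw hs f
  obtain ⟨R, hR⟩ := Finite.exists_ge v
  set T := max (A + 1) (max 0 (N / lam + 1)) with hT
  have hx : ∀ x, T ≤ v x + (T - R) := fun x => by linarith [hR x]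
  refine ⟨fun x => v x + (T - R), fun x => ?_, fun x => ?_, fun x => ?_⟩
  · linarith [hx x, le_max_left (A + 1) (max 0 (N / lam + 1))]
  · have h1 : 0 ≤ v x + (T - R) := ((le_max_left _ _).trans (le_max_right _ _)).trans (hx x)
    have h2 : N / lam + 1 ≤ v x + (T - R) :=
      ((le_max_right _ _).trans (le_max_right _ _)).trans (hx x)
    have h3 : N / lam < higgs (v x + (T - R)) := by linarith [le_higgs h1]
    rw [div_lt_iff₀ hlam] at h3
    linarith
  · rw [graphLaplacian_add_const, hv x]

/-- The parameters of a fixed sign `σ` for which the equation is solvable have a smallest modulus,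
which is attained: solutions are bounded, and integrating the equation bounds the modulus from
below. -/
lemma exists_threshold (hG : G.Connected) (hμ : ∀ x, 0 < μ x)
    (hw : ∀ x y, G.Adj x y → 0 < w x y) (hs : ∀ x y, G.Adj x y → w x y = w y x)
    {σ : ℝ} (hσ : |σ| = 1) (hf : 0 < σ * vertexIntegral μ f)
    (hex : ∃ k : ℝ, 0 < k ∧ ∃ u, IsChernSimonsHiggsSolution G μ w (σ * k) f u) :
    ∃ L : ℝ, 0 < L ∧ (∃ u, IsChernSimonsHiggsSolution G μ w (σ * L) f u) ∧
      ∀ k, 0 < k → k < L → ¬ ∃ u, IsChernSimonsHiggsSolution G μ w (σ * k) f u := by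
  have hne := hG.nonempty
  have hvol : 0 < ∑ x, μ x := Finset.sum_pos (fun x _ => hμ x) Finset.univ_nonempty
  have hσ2 : σ * σ = 1 := by rw [← abs_mul_abs_self, hσ, one_mul]
  set m := 4 * (σ * vertexIntegral μ f) / ∑ x, μ x with hm
  have hm0 : 0 < m := by positivity
  have hlow : ∀ k, 0 < k → ∀ u, IsChernSimonsHiggsSolution G μ w (σ * k) f u → m ≤ k := by
    intro k hk u hu
    rw [isChernSimonsHiggsSolution_iff] at hu
    have h1 := mul_sum_higgs hμ hs hu
    have h2 : -(1 / 4) * ∑ x, μ x ≤ ∑ x, μ x * higgs (u x) := by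
      rw [Finset.mul_sum]
      refine Finset.sum_le_sum fun x _ => ?_
      have := mul_le_mul_of_nonneg_left (neg_quarter_le_higgs (u x)) (hμ x).le
      linarith
    have h3 : k * ∑ x, μ x * higgs (u x) = - (σ * vertexIntegral μ f) := by
      calc k * ∑ x, μ x * higgs (u x) = (σ * σ) * (k * ∑ x, μ x * higgs (u x)) := by
            rw [hσ2, one_mul]
        _ = σ * (σ * k * ∑ x, μ x * higgs (u x)) := by ring
        _ = _ := by rw [h1]; ring
    have h4 := mul_le_mul_of_nonneg_left h2 hk.le
    rw [hm, div_le_iff₀ hvol]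
    linarith
  obtain ⟨k₁, hk₁, u₁, hu₁⟩ := hex
  obtain ⟨ρ, hρ⟩ := exists_solution_bound (Λ := k₁) hG hμ hw hs
    (f := f) (by rintro h; simp [h] at hf) hm0
  have habs : ∀ k : ℝ, 0 < k → |σ * k| = k := fun k hk => by
    rw [abs_mul, hσ, one_mul, abs_of_pos hk]
  have hρ0 : 0 ≤ ρ := (abs_nonneg _).trans
    (hρ (σ * k₁) (by rw [habs k₁ hk₁]; exact hlow k₁ hk₁ u₁ hu₁) (habs k₁ hk₁).le u₁ hu₁
      (Classical.arbitrary V))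
  let T : Set (ℝ × (V → ℝ)) :=
    (Set.Icc m k₁ ×ˢ Metric.closedBall 0 ρ) ∩
      {p | ∀ x, graphLaplacian G μ w p.2 x = σ * p.1 * higgs (p.2 x) + f x}
  have hT : IsCompact T := by
    refine (isCompact_Icc.prod (isCompact_closedBall 0 ρ)).inter_right ?_
    simp only [Set.ofPred_forall]
    refine isClosed_iInter fun x => isClosed_eq ?_ ?_
    · exact ((continuous_apply x).comp continuous_graphLaplacian).comp continuous_snd
    · exact ((continuous_const.mul continuous_fst).mul
        (continuous_higgs.comp ((continuous_apply x).comp continuous_snd))).add continuous_const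
  have hmemT : ∀ k, 0 < k → k ≤ k₁ → ∀ u, IsChernSimonsHiggsSolution G μ w (σ * k) f u →
      k ∈ Prod.fst '' T := fun k hk hkk u hu => by
    refine ⟨(k, u), ⟨⟨⟨hlow k hk u hu, hkk⟩, ?_⟩, isChernSimonsHiggsSolution_iff.1 hu⟩, rfl⟩
    refine mem_closedBall_zero_iff.2 (pi_norm_le_iff_of_nonneg hρ0 |>.2 fun x => ?_)
    exact hρ (σ * k) (by rw [habs k hk]; exact hlow k hk u hu) (by rwa [habs k hk]) u hu x
  obtain ⟨L, ⟨⟨L', u⟩, hLT, rfl⟩, hmin⟩ := (hT.image continuous_fst).exists_isLeast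
    ⟨k₁, hmemT k₁ hk₁ le_rfl u₁ hu₁⟩
  refine ⟨L', hm0.trans_le hLT.1.1.1, ⟨u, isChernSimonsHiggsSolution_iff.2 hLT.2⟩, ?_⟩
  rintro k hk hkL ⟨v, hv⟩
  exact absurd (hmin (hmemT k hk (hkL.le.trans hLT.1.1.2) v hv)) (not_le.2 hkL)

lemma exists_solution_of_neg_integral (hG : G.Connected) (hμ : ∀ x, 0 < μ x)
    (hw : ∀ x y, G.Adj x y → 0 < w x y) (hs : ∀ x y, G.Adj x y → w x y = w y x)
    (hlam : 0 < lam) (hf : vertexIntegral μ f / ∑ x, μ x < 0) :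
    ∃ u, IsChernSimonsHiggsSolution G μ w lam f u := by
  obtain ⟨b, hb0, hbN, hb⟩ := exists_high_poisson hG hμ hw hs f hlam 0
    (- (vertexIntegral μ f / ∑ x, μ x))
  obtain ⟨a, ha0, haN, ha⟩ := exists_low_poisson hG hμ hw hs f lam 0 (neg_pos.2 hf)
  obtain ⟨u, -, -, hu⟩ := exists_higgs_solution_between (lam := lam) (f := f) hμ hw
    (fun x => ((ha0 x).trans (hb0 x)).le)
    (fun x => by rw [ha x]; linarith [(abs_lt.1 (haN x)).2])
    (fun x => by rw [hb x]; linarith [hbN x])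
  exact ⟨u, hu⟩

lemma exists_solution_of_pos_integral (hG : G.Connected) (hμ : ∀ x, 0 < μ x)
    (hw : ∀ x y, G.Adj x y → 0 < w x y) (hs : ∀ x y, G.Adj x y → w x y = w y x)
    (hlam : lam < 0) (hf : 0 < vertexIntegral μ f / ∑ x, μ x) :
    ∃ u, IsChernSimonsHiggsSolution G μ w lam f u := by
  obtain ⟨a, ha0, haN, ha⟩ := exists_high_poisson hG hμ hw hs f (neg_pos.2 hlam) 0
    (vertexIntegral μ f / ∑ x, μ x)
  obtain ⟨b, hb0, hbN, hb⟩ := exists_low_poisson hG hμ hw hs f lam 0 hf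
  obtain ⟨u, hu, -⟩ := exists_higgs_solution_of_reversed (lam := lam) (f := f) hG hμ hw hs hlam.ne
    (fun x => (hb0 x).trans (ha0 x))
    (fun x => by rw [ha x]; linarith [haN x])
    (fun x => by rw [hb x]; linarith [(abs_lt.1 (hbN x)).1])
  exact ⟨u, hu⟩

/-- For large positive `lam` the constant `-log 2`, where `eˢ (eˢ - 1)` is minimal, is a
subsolution. -/
lemma exists_pos_solvable (hG : G.Connected) (hμ : ∀ x, 0 < μ x)
    (hw : ∀ x y, G.Adj x y → 0 < w x y) (hs : ∀ x y, G.Adj x y → w x y = w y x) (f : V → ℝ) :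
    ∃ k : ℝ, 0 < k ∧ ∃ u, IsChernSimonsHiggsSolution G μ w k f u := by
  obtain ⟨M, hM⟩ := Finite.exists_le fun x => |f x|
  have hM0 : 0 ≤ M := (abs_nonneg _).trans (hM (Classical.choice hG.nonempty))
  have hk : 0 < 4 * M + 1 := by positivity
  obtain ⟨b, hb0, hbN, hb⟩ := exists_high_poisson hG hμ hw hs f hk 0
    (- (vertexIntegral μ f / ∑ x, μ x))
  have hlog : higgs (-Real.log 2) = -(1 / 4) := by
    unfold higgs
    rw [Real.exp_neg, Real.exp_log two_pos]
    norm_num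
  obtain ⟨u, -, -, hu⟩ := exists_higgs_solution_between (lam := 4 * M + 1) (f := f)
    (a := fun _ => -Real.log 2) hμ hw
    (fun x => show -Real.log 2 ≤ b x by linarith [hb0 x, Real.log_pos one_lt_two])
    (fun x => by rw [graphLaplacian_const, hlog]; linarith [le_abs_self (f x), hM x])
    (fun x => by rw [hb x]; linarith [hbN x])
  exact ⟨_, hk, u, hu⟩

/-- For large negative `lam` the constant `-log 2`, where `eˢ (eˢ - 1)` is minimal, is a
supersolution. -/
lemma exists_neg_solvable (hG : G.Connected) (hμ : ∀ x, 0 < μ x)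
    (hw : ∀ x y, G.Adj x y → 0 < w x y) (hs : ∀ x y, G.Adj x y → w x y = w y x)
    (hf : vertexIntegral μ f / ∑ x, μ x < 0) :
    ∃ k : ℝ, 0 < k ∧ ∃ u, IsChernSimonsHiggsSolution G μ w (-k) f u := by
  obtain ⟨M, hM⟩ := Finite.exists_le fun x => |f x|
  have hM0 : 0 ≤ M := (abs_nonneg _).trans (hM (Classical.choice hG.nonempty))
  have hk : 0 < 4 * M + 1 := by positivity
  obtain ⟨a, ha0, haN, ha⟩ := exists_low_poisson hG hμ hw hs f (-(4 * M + 1)) (-Real.log 2)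
    (neg_pos.2 hf)
  have hlog : higgs (-Real.log 2) = -(1 / 4) := by
    unfold higgs
    rw [Real.exp_neg, Real.exp_log two_pos]
    norm_num
  obtain ⟨u, -, -, hu⟩ := exists_higgs_solution_between (lam := -(4 * M + 1)) (f := f)
    (b := fun _ => -Real.log 2) hμ hw
    (fun x => (ha0 x).le)
    (fun x => by rw [ha x]; linarith [(abs_lt.1 (haN x)).2])
    (fun x => by rw [graphLaplacian_const, hlog]; linarith [neg_abs_le (f x), hM x])
  exact ⟨_, hk, u, hu⟩

/-- Solvability for a positive parameter `k` gives two solutions for every larger one: a translate of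
the given solution is a strict subsolution, with one solution above it; together with a very low
supersolution, in the reversed order, it gives another one that is not above it. -/
lemma exists_two_solutions_pos (hG : G.Connected) (hμ : ∀ x, 0 < μ x)
    (hw : ∀ x y, G.Adj x y → 0 < w x y) (hs : ∀ x y, G.Adj x y → w x y = w y x)
    (hf : 0 < vertexIntegral μ f / ∑ x, μ x) {k l : ℝ} (hk : 0 < k) (hkl : k < l)
    {u₀ : V → ℝ} (hu₀ : IsChernSimonsHiggsSolution G μ w k f u₀) :
    ∃ u v : V → ℝ, u ≠ v ∧ IsChernSimonsHiggsSolution G μ w l f u ∧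
      IsChernSimonsHiggsSolution G μ w l f v := by
  have hl : 0 < l := hk.trans hkl
  rw [isChernSimonsHiggsSolution_iff] at hu₀
  set a : V → ℝ := fun x => u₀ x + Real.log (k / l) with ha
  have hsub : ∀ x, l * higgs (a x) + f x < graphLaplacian G μ w a x := fun x => by
    rw [ha, graphLaplacian_add_const, hu₀ x]
    linarith [mul_higgs_lt_mul_higgs_shift hk hkl (u₀ x)]
  obtain ⟨A, hA⟩ := Finite.exists_le a
  obtain ⟨A', hA'⟩ := Finite.exists_ge a
  obtain ⟨b, hb0, hbN, hb⟩ := exists_high_poisson hG hμ hw hs f hl A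
    (- (vertexIntegral μ f / ∑ x, μ x))
  obtain ⟨c, hc0, hcN, hc⟩ := exists_low_poisson hG hμ hw hs f l A' hf
  obtain ⟨u, hau, -, hu⟩ := exists_higgs_solution_between (lam := l) (f := f) hμ hw
    (fun x => ((hA x).trans_lt (hb0 x)).le) (fun x => (hsub x).le)
    (fun x => by rw [hb x]; linarith [hbN x])
  obtain ⟨v, hv, hv1, -⟩ := exists_higgs_solution_of_reversed (lam := l) (f := f) hG hμ hw hs
    hl.ne' (fun x => (hc0 x).trans_le (hA' x)) hsub
    (fun x => by rw [hc x]; linarith [(abs_lt.1 (hcN x)).1])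
  refine ⟨u, v, ?_, hu, hv⟩
  rintro rfl
  exact hv1 (lt_of_le_of_strict_sub (g := fun s => l * higgs s) hμ hw hau hsub
    (isChernSimonsHiggsSolution_iff.1 hu))

/-- Solvability for a negative parameter `-k` gives two solutions for every smaller one: a translate
of the given solution is a strict supersolution, with one solution below it; together with a very
high subsolution, in the reversed order, it gives another one that is not below it. -/
lemma exists_two_solutions_neg (hG : G.Connected) (hμ : ∀ x, 0 < μ x)
    (hw : ∀ x y, G.Adj x y → 0 < w x y) (hs : ∀ x y, G.Adj x y → w x y = w y x)
    (hf : vertexIntegral μ f / ∑ x, μ x < 0) {k l : ℝ} (hk : 0 < k) (hkl : k < l)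
    {u₀ : V → ℝ} (hu₀ : IsChernSimonsHiggsSolution G μ w (-k) f u₀) :
    ∃ u v : V → ℝ, u ≠ v ∧ IsChernSimonsHiggsSolution G μ w (-l) f u ∧
      IsChernSimonsHiggsSolution G μ w (-l) f v := by
  have hl : 0 < l := hk.trans hkl
  rw [isChernSimonsHiggsSolution_iff] at hu₀
  set b : V → ℝ := fun x => u₀ x + Real.log (k / l) with hb
  have hsup : ∀ x, graphLaplacian G μ w b x < -l * higgs (b x) + f x := fun x => by
    rw [hb, graphLaplacian_add_const, hu₀ x]
    linarith [mul_higgs_lt_mul_higgs_shift hk hkl (u₀ x)]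
  obtain ⟨A, hA⟩ := Finite.exists_le b
  obtain ⟨A', hA'⟩ := Finite.exists_ge b
  obtain ⟨a, ha0, haN, ha⟩ := exists_high_poisson hG hμ hw hs f hl A
    (vertexIntegral μ f / ∑ x, μ x)
  obtain ⟨c, hc0, hcN, hc⟩ := exists_low_poisson hG hμ hw hs f (-l) A' (neg_pos.2 hf)
  obtain ⟨u, -, hub, hu⟩ := exists_higgs_solution_between (lam := -l) (f := f) hμ hw
    (fun x => ((hc0 x).trans_le (hA' x)).le)
    (fun x => by rw [hc x]; linarith [(abs_lt.1 (hcN x)).2]) (fun x => (hsup x).le)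
  obtain ⟨v, hv, -, hv1⟩ := exists_higgs_solution_of_reversed (lam := -l) (f := f) hG hμ hw hs
    (neg_ne_zero.2 hl.ne') (fun x => (hA x).trans_lt (ha0 x))
    (fun x => by rw [ha x]; linarith [haN x]) hsup
  refine ⟨u, v, ?_, hu, hv⟩
  rintro rfl
  exact hv1 (lt_of_le_of_strict_super (g := fun s => -l * higgs s) hμ hw hub hsup
    (isChernSimonsHiggsSolution_iff.1 hu))

end Equation

theorem theorem3 {V : Type*} [Fintype V] (G : SimpleGraph V) [DecidableRel G.Adj]
    (hG : G.Connected)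
    (μ : V → ℝ) (hμ : ∀ x, 0 < μ x)
    (w : V → V → ℝ) (hw_pos : ∀ x y, G.Adj x y → 0 < w x y)
    (hw_symm : ∀ x y, G.Adj x y → w x y = w y x)
    (f : V → ℝ) :
    (∀ lam : ℝ, lam * vertexIntegral μ f < 0 →
      ∃ u : V → ℝ, IsChernSimonsHiggsSolution G μ w lam f u) ∧
    (0 < vertexIntegral μ f →
      ∃ L : ℝ, 0 < L ∧
        (∀ lam : ℝ, L < lam →
          ∃ u v : V → ℝ, u ≠ v ∧ IsChernSimonsHiggsSolution G μ w lam f u ∧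
            IsChernSimonsHiggsSolution G μ w lam f v) ∧
        (∀ lam : ℝ, 0 < lam → lam < L →
          ¬ ∃ u : V → ℝ, IsChernSimonsHiggsSolution G μ w lam f u) ∧
        (∃ u : V → ℝ, IsChernSimonsHiggsSolution G μ w L f u)) ∧
    (vertexIntegral μ f < 0 →
      ∃ L : ℝ, L < 0 ∧
        (∀ lam : ℝ, lam < L →
          ∃ u v : V → ℝ, u ≠ v ∧ IsChernSimonsHiggsSolution G μ w lam f u ∧
            IsChernSimonsHiggsSolution G μ w lam f v) ∧
        (∀ lam : ℝ, L < lam → lam < 0 →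
          ¬ ∃ u : V → ℝ, IsChernSimonsHiggsSolution G μ w lam f u) ∧
        (∃ u : V → ℝ, IsChernSimonsHiggsSolution G μ w L f u)) := by
  have hne := hG.nonempty
  have hvol : 0 < ∑ x, μ x := Finset.sum_pos (fun x _ => hμ x) Finset.univ_nonempty
  refine ⟨fun lam h => ?_, fun h => ?_, fun h => ?_⟩
  · rcases mul_neg_iff.1 h with ⟨hl, hf⟩ | ⟨hl, hf⟩
    · exact exists_solution_of_neg_integral hG hμ hw_pos hw_symm hl (div_neg_of_neg_of_pos hf hvol)
    · exact exists_solution_of_pos_integral hG hμ hw_pos hw_symm hl (div_pos hf hvol)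
  · obtain ⟨L, hL, ⟨u, hu⟩, hmin⟩ := exists_threshold (σ := 1) hG hμ hw_pos hw_symm (f := f)
      (by simp) (by simpa using h)
      (by simpa using exists_pos_solvable hG hμ hw_pos hw_symm f)
    simp only [one_mul] at hu hmin
    exact ⟨L, hL, fun lam hlam =>
      exists_two_solutions_pos hG hμ hw_pos hw_symm (div_pos h hvol) hL hlam hu, hmin, u, hu⟩
  · obtain ⟨L, hL, ⟨u, hu⟩, hmin⟩ := exists_threshold (σ := -1) hG hμ hw_pos hw_symm (f := f)
      (by simp) (by simpa using h)
      (by simpa using exists_neg_solvable hG hμ hw_pos hw_symm (div_neg_of_neg_of_pos h hvol))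
    simp only [neg_mul, one_mul] at hu hmin
    refine ⟨-L, neg_neg_of_pos hL, fun lam hlam => ?_, fun lam h1 h2 => ?_, u, hu⟩
    · have := exists_two_solutions_neg hG hμ hw_pos hw_symm (div_neg_of_neg_of_pos h hvol) hL
        (l := -lam) (by linarith) hu
      simpa using this
    · simpa using hmin (-lam) (by linarith) (by linarith)
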